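/- Let $\kappa>0$ (the wave number), $R>0$, $\alpha>0$ and let $k\ge 0$ be an integer. Let $P_n$ be the Legendre polynomials, $j_n,y_n$ the spherical Bessel functions and $h_n^{(1)}=j_n+iy_n$. Let $(m_l)_{l\ge0}$ and $(u_s)_{s\ge0}$ be sequences of measurable complex-valued functions on $[0,R]$ with $$\sup_{0\le\rho\le R}|m_l(\rho)|\le \frac{A}{l^{k+2+\alpha}}\quad(l\ge1),\qquad \sup_{0\le\rho\le R}|u_s(\rho)|\le \frac{B}{s^{k+4+\alpha}}\quad(s\ge1),$$ and put $m(\rho,\theta)=\sum_{l\ge0}m_l(\rho)P_l(\cos\theta)$ and, for an integer $F\ge1$, $u^T(\rho,\theta)=\sum_{s>F}u_s(\rho)P_s(\cos\theta)$. For a function $v(\rho,\theta)$ and $\tilde\rho\ge0$ let $$(K_nv)(\tilde\rho)=-(2n+1)\kappa^3\int_0^R h_n^{(1)}(\kappa\max(\tilde\rho,\rho))\,j_n(\kappa\min(\tilde\rho,\rho))\,\rho^2\int_0^\pi v(\rho,\theta)\,m(\rho,\theta)\,P_n(\cos\theta)\sin\theta\,d\theta\,d\rho,$$ $$(K^Fv)(\tilde\rho,\theta)=\sum_{n=0}^F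 (K_nv)(\tilde\rho)\,P_n(\cos\theta).$$ Let $\|\cdot\|_\infty$ denote the supremum over all $\tilde\rho\ge0$ and all $\theta$. Then there is a constant $C>0$, depending only on $\kappa,R,k,\alpha$, such that: * if $k\ge1$, then $\displaystyle \|K^Fu^T\|_\infty\le C\,A\,B\;F^{-\left(k+4.5+\alpha+\min(1.5,\,k+\alpha)\right)}$ for all $F\ge1$; * if $k=0$, then $\displaystyle \|K^Fu^T\|_\infty\le C\,A\,B\;\log F\cdot F^{-\left(4.5+\alpha+\min(1,\,0.5+\alpha)\right)}$ for all $F\ge2$. -/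

import Mathlib

open scoped BigOperators

noncomputable section

namespace HelmholtzScattering

/-- The Legendre polynomial `Pₙ`, by Rodrigues' formula. -/
def legendreP (n : ℕ) : Polynomial ℝ :=
  Polynomial.C (1 / (2 ^ n * (n.factorial : ℝ))) *
    Polynomial.derivative^[n] ((Polynomial.X ^ 2 - 1) ^ n)

/-- The spherical Bessel function of the first kind,
`jₙ(x) = xⁿ / (1·3·5⋯(2n+1)) · [1 - (x²/2)/(1!(2n+3)) + (x²/2)²/(2!(2n+3)(2n+5)) - ⋯]`. -/
def sphericalJ (n : ℕ) (x : ℝ) : ℝ :=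
  x ^ n / (∏ i ∈ Finset.range (n + 1), (2 * (i : ℝ) + 1)) *
    ∑' q : ℕ, (-(x ^ 2 / 2)) ^ q /
      ((q.factorial : ℝ) * ∏ i ∈ Finset.range q, (2 * (n : ℝ) + 3 + 2 * (i : ℝ)))

/-- The spherical Bessel function of the second kind (for `x > 0`),
`yₙ(x) = -(1·1·3·5⋯(2n-1)) / xⁿ⁺¹ · [1 - (x²/2)/(1!(1-2n)) + (x²/2)²/(2!(1-2n)(3-2n)) - ⋯]`.
The factors `2i+1-2n` are odd integers, hence never zero. -/
def sphericalY (n : ℕ) (x : ℝ) : ℝ :=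
  -((∏ i ∈ Finset.range n, (2 * (i : ℝ) + 1)) / x ^ (n + 1)) *
    ∑' q : ℕ, (-(x ^ 2 / 2)) ^ q /
      ((q.factorial : ℝ) * ∏ i ∈ Finset.range q, (2 * (i : ℝ) + 1 - 2 * (n : ℝ)))

/-- The spherical Hankel function of the first kind, `hₙ⁽¹⁾ = jₙ + i yₙ`. -/
def sphericalH (n : ℕ) (x : ℝ) : ℂ :=
  (sphericalJ n x : ℂ) + Complex.I * (sphericalY n x : ℂ)

/-- The function `∑_{l ≥ 0} c_l(ρ) P_l(cos θ)` with Legendre coefficients `c_l(ρ)`. -/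
def legendreSeries (c : ℕ → ℝ → ℂ) (ρ θ : ℝ) : ℂ :=
  ∑' l : ℕ, c l ρ * (((legendreP l).eval (Real.cos θ) : ℝ) : ℂ)

/-- The tail `u^T = ∑_{s > F} u_s(ρ) P_s(cos θ)` of a Legendre series. -/
def legendreTail (u : ℕ → ℝ → ℂ) (F : ℕ) (ρ θ : ℝ) : ℂ :=
  ∑' s : ℕ, u (F + 1 + s) ρ * (((legendreP (F + 1 + s)).eval (Real.cos θ) : ℝ) : ℂ)

/-- The angular integral `Iₙ(ρ) = ∫₀^π v(ρ,θ) M(ρ,θ) Pₙ(cos θ) sin θ dθ`. -/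
def angularIntegral (M v : ℝ → ℝ → ℂ) (n : ℕ) (ρ : ℝ) : ℂ :=
  ∫ θ in (0 : ℝ)..Real.pi,
    v ρ θ * M ρ θ * (((legendreP n).eval (Real.cos θ) : ℝ) : ℂ) * ((Real.sin θ : ℝ) : ℂ)

/-- `(Kₙ v)(a) = -(2n+1) κ³ ∫₀^R hₙ⁽¹⁾(κ max(a,ρ)) jₙ(κ min(a,ρ)) Iₙ(ρ) ρ² dρ`,
with wave number `κ`. -/
def radialOperator (κ R : ℝ) (M : ℝ → ℝ → ℂ) (n : ℕ) (v : ℝ → ℝ → ℂ) (a : ℝ) : ℂ :=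
  -((2 * (n : ℂ) + 1) * (κ : ℂ) ^ 3) *
    ∫ ρ in (0 : ℝ)..R,
      sphericalH n (κ * max a ρ) * (sphericalJ n (κ * min a ρ) : ℂ) *
        angularIntegral M v n ρ * (ρ : ℂ) ^ 2

/-- `(K^F v)(a, cos θ) = ∑_{n=0}^{F} (Kₙ v)(a) Pₙ(cos θ)`. -/
def truncatedOperator (κ R : ℝ) (M : ℝ → ℝ → ℂ) (F : ℕ) (v : ℝ → ℝ → ℂ) (a θ : ℝ) : ℂ :=
  ∑ n ∈ Finset.range (F + 1),
    radialOperator κ R M n v a * (((legendreP n).eval (Real.cos θ) : ℝ) : ℂ)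

end HelmholtzScattering

end

/-!
Green's kernel `hₙ(κ max(a,ρ)) jₙ(κ min(a,ρ))` is at most a constant times
`(min/max)ⁿ / ((2n+1) κ max)`: the power series of `jₙ` controls `|jₙ(x)|` by its leading term, and
`|hₙ|` is dominated by the decreasing solution of the three-term recurrence with all signs made
positive. Hence the kernel concentrates near `ρ = a`, and the radial integral gains a factor
`1/(n+1)`.

The angular integral expands into the triple products `∫ Pₗ Pₛ Pₙ`. By orthogonality these vanish
unless `l ≥ s - n`, so `s > F` forces `l ≥ F + 1 - n`. Cauchy–Schwarz, together with the symmetry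
in `l` and `n`, bounds them by `2 (s+1)^(-1/2) (l+1)^(-β) (n+1)^(-(1/2-β))` for every
`0 ≤ β ≤ 1/2`.

With `γ = k + α`, summation over `s` and `l` gives `F^(-(γ+4.5))` times the convolution
`∑ₙ (n+1)^(-(3/2-β)) (F+1-n)^(-(γ+β))`. If `γ > 1`, then `β = 0` makes both sequences summable and
the slower one decides. For smaller `γ` the choice `β = 1/2` is better; the first sequence is then
harmonic, whence the logarithm.
-/

namespace HelmholtzScattering

open Polynomial MeasureTheory

noncomputable section

/-! ### Legendre polynomials -/

section Legendre

theorem natDegree_legendreP_le (n : ℕ) : (legendreP n).natDegree ≤ n := by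
  have h : ((X ^ 2 - 1 : ℝ[X]) ^ n).natDegree ≤ n * 2 :=
    natDegree_pow_le.trans (Nat.mul_le_mul_left _ (by compute_degree))
  refine (natDegree_C_mul_le _ _).trans ((natDegree_iterate_derivative _ _).trans ?_)
  omega

theorem eval_iterate_derivative_X_sub_C_pow_mul (n : ℕ) (c : ℝ) (q : ℝ[X]) :
    (derivative^[n] ((X - C c) ^ n * q)).eval c = n.factorial * q.eval c := by
  rw [iterate_derivative_mul, eval_finsetSum, Finset.sum_eq_single 0]
  · simp [iterate_derivative_X_sub_pow_self]
  · intro k hk hk0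
    rw [iterate_derivative_X_sub_pow, Nat.sub_sub_self (Finset.mem_range_succ_iff.mp hk)]
    simp [hk0]
  · simp

theorem legendreP_eval_one (n : ℕ) : (legendreP n).eval 1 = 1 := by
  have hfactor : (X ^ 2 - 1 : ℝ[X]) ^ n = (X - C 1) ^ n * (X + 1) ^ n := by
    rw [← mul_pow, map_one]
    ring
  rw [legendreP, hfactor, eval_mul, eval_iterate_derivative_X_sub_C_pow_mul]
  simp only [eval_C, eval_pow, eval_add, eval_X, eval_one]
  norm_num
  field_simp

theorem legendreP_eval_neg_one (n : ℕ) : (legendreP n).eval (-1) = (-1) ^ n := by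
  have hfactor : (X ^ 2 - 1 : ℝ[X]) ^ n = (X - C (-1)) ^ n * (X - 1) ^ n := by
    rw [← mul_pow, map_neg, map_one]
    ring
  rw [legendreP, hfactor, eval_mul, eval_iterate_derivative_X_sub_C_pow_mul]
  simp only [eval_C, eval_pow, eval_sub, eval_X, eval_one]
  rw [show (-1 - 1 : ℝ) = -1 * 2 by norm_num, mul_pow]
  field_simp

theorem iterate_derivative_X_sq_sub_one_pow_ode (n k : ℕ) :
    (X ^ 2 - 1) * derivative^[k + 2] ((X ^ 2 - 1 : ℝ[X]) ^ n)
        + 2 * ((k : ℝ[X]) + 1 - (n : ℝ[X])) * X * derivative^[k + 1] ((X ^ 2 - 1 : ℝ[X]) ^ n)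
      = ((k : ℝ[X]) + 1) * (2 * (n : ℝ[X]) - (k : ℝ[X]))
        * derivative^[k] ((X ^ 2 - 1 : ℝ[X]) ^ n) := by
  set w : ℝ[X] := (X ^ 2 - 1) ^ n with hw
  induction k with
  | zero =>
    have first_order : (X ^ 2 - 1) * derivative w = 2 * (n : ℝ[X]) * X * w := by
      rcases n with _ | n
      · simp [hw]
      · simp only [hw, derivative_pow, derivative_sub, derivative_X, derivative_one,
          Nat.add_sub_cancel, map_natCast]
        push_cast
        ring
    have := congrArg derivative first_order
    simp only [derivative_mul, derivative_sub, derivative_X_pow, derivative_one, derivative_X,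
      derivative_natCast, derivative_ofNat, map_natCast] at this
    simp only [Function.iterate_succ, Function.iterate_zero, Function.comp_apply, id]
    push_cast at this ⊢
    linear_combination this
  | succ k ih =>
    have := congrArg derivative ih
    simp only [derivative_add, derivative_mul, derivative_sub, derivative_X_pow, derivative_one,
      derivative_X, derivative_natCast, derivative_ofNat, map_natCast,
      ← Function.iterate_succ_apply' derivative] at this
    push_cast at this ⊢
    linear_combination this

theorem legendreP_ode (n : ℕ) :
    (X ^ 2 - 1) * derivative (derivative (legendreP n)) + 2 * X * derivative (legendreP n)
      = (n * (n + 1) : ℝ[X]) * legendreP n := by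
  have h := iterate_derivative_X_sq_sub_one_pow_ode n n
  simp only [legendreP, derivative_C_mul, ← Function.iterate_succ_apply' derivative]
  linear_combination C (1 / (2 ^ n * (n.factorial : ℝ))) * h

/-- The quadratic form `n(n+1) Pₙ² + (1-x²) Pₙ'²`, whose derivative along the Legendre equation is
`2x Pₙ'²`; it majorizes `n(n+1) Pₙ²` on `[-1,1]`. -/
def legendreEnergy (n : ℕ) : ℝ[X] :=
  (n * (n + 1) : ℝ[X]) * legendreP n ^ 2 + (1 - X ^ 2) * derivative (legendreP n) ^ 2

theorem derivative_legendreEnergy (n : ℕ) :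
    derivative (legendreEnergy n) = 2 * X * derivative (legendreP n) ^ 2 := by
  simp only [legendreEnergy, derivative_add, derivative_mul, derivative_sub, derivative_X,
    derivative_one, derivative_natCast, derivative_pow, map_natCast]
  push_cast
  linear_combination (-2 * derivative (legendreP n)) * legendreP_ode n

theorem legendreEnergy_eval_le (n : ℕ) {x : ℝ} (hx : x ∈ Set.Icc (-1 : ℝ) 1) :
    (legendreEnergy n).eval x ≤ n * (n + 1) := by
  have hderiv (y : ℝ) : deriv (fun z => (legendreEnergy n).eval z) y
      = 2 * y * (derivative (legendreP n)).eval y ^ 2 := by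
    simp [Polynomial.deriv, derivative_legendreEnergy]
  rcases le_total 0 x with h0 | h0
  · have hmono : MonotoneOn (fun z => (legendreEnergy n).eval z) (Set.Icc 0 1) :=
      monotoneOn_of_deriv_nonneg (convex_Icc 0 1) (legendreEnergy n).continuousOn
        (legendreEnergy n).differentiableOn fun y hy => by
          rw [interior_Icc] at hy
          have := hy.1
          rw [hderiv]
          positivity
    have h := hmono ⟨h0, hx.2⟩ ⟨zero_le_one, le_rfl⟩ hx.2
    simpa [legendreEnergy, legendreP_eval_one] using h
  · have hanti : AntitoneOn (fun z => (legendreEnergy n).eval z) (Set.Icc (-1) 0) :=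
      antitoneOn_of_deriv_nonpos (convex_Icc (-1) 0) (legendreEnergy n).continuousOn
        (legendreEnergy n).differentiableOn fun y hy => by
          rw [interior_Icc] at hy
          rw [hderiv]
          exact mul_nonpos_of_nonpos_of_nonneg (by linarith [hy.2]) (sq_nonneg _)
    have h := hanti ⟨le_rfl, by norm_num⟩ ⟨hx.1, h0⟩ hx.1
    simpa [legendreEnergy, legendreP_eval_neg_one, ← pow_mul, mul_comm _ 2] using h

theorem abs_legendreP_eval_le_one (n : ℕ) {x : ℝ} (hx : x ∈ Set.Icc (-1 : ℝ) 1) :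
    |(legendreP n).eval x| ≤ 1 := by
  rcases Nat.eq_zero_or_pos n with rfl | hn
  · simp [legendreP]
  have hx2 : x ^ 2 ≤ 1 := by nlinarith [hx.1, hx.2]
  have hdrop : (n * (n + 1) : ℝ) * (legendreP n).eval x ^ 2 ≤ (legendreEnergy n).eval x := by
    have := mul_nonneg (sub_nonneg.2 hx2) (sq_nonneg ((derivative (legendreP n)).eval x))
    simpa [legendreEnergy] using this
  have hN : (0 : ℝ) < n * (n + 1) := by positivity
  rw [← sq_le_one_iff_abs_le_one]
  exact le_of_mul_le_mul_left
    ((hdrop.trans (legendreEnergy_eval_le n hx)).trans_eq (mul_one _).symm) hN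

theorem integral_mul_iterate_derivative_eq_zero {n : ℕ} {w : ℝ[X]} (hw : (X ^ 2 - 1) ^ n ∣ w)
    {j : ℕ} (hj : j ≤ n) {q : ℝ[X]} (hq : derivative^[j] q = 0) :
    ∫ x in (-1 : ℝ)..1, q.eval x * (derivative^[j] w).eval x = 0 := by
  induction j generalizing q with
  | zero => simp_all
  | succ j ih =>
    have hroot (y : ℝ) (hy : y ^ 2 = 1) : (derivative^[j] w).eval y = 0 := by
      obtain ⟨r, hr⟩ : (X ^ 2 - 1 : ℝ[X]) ∣ derivative^[j] w :=
        (dvd_pow_self _ (by omega)).trans (pow_sub_dvd_iterate_derivative_of_pow_dvd j hw)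
      simp [hr, hy]
    rw [Function.iterate_succ_apply', intervalIntegral.integral_mul_deriv_eq_deriv_mul
        (fun x _ => q.hasDerivAt x) (fun x _ => (derivative^[j] w).hasDerivAt x)
        ((derivative q).continuous.intervalIntegrable _ _)
        ((derivative _).continuous.intervalIntegrable _ _),
      hroot 1 (by norm_num), hroot (-1) (by norm_num), ih (by omega) hq]
    simp

theorem integral_mul_legendreP_eq_zero {n : ℕ} {q : ℝ[X]} (hq : q.degree < n) :
    ∫ x in (-1 : ℝ)..1, q.eval x * (legendreP n).eval x = 0 := by
  have h := integral_mul_iterate_derivative_eq_zero (n := n) dvd_rfl le_rfl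
    (iterate_derivative_eq_zero_of_degree_lt hq)
  simp only [legendreP, eval_mul, eval_C, mul_left_comm (eval _ q)]
  rw [intervalIntegral.integral_const_mul, h, mul_zero]

theorem degree_X_mul_derivative_legendreP_sub_lt (n : ℕ) :
    (X * derivative (legendreP n) - C (n : ℝ) * legendreP n).degree < (n : WithBot ℕ) := by
  refine (degree_lt_iff_coeff_zero _ _).2 fun k hk => ?_
  rcases hk.eq_or_lt with rfl | hk
  · cases n with
    | zero => simp
    | succ n =>
      rw [coeff_sub, coeff_X_mul, coeff_C_mul, coeff_derivative]
      push_cast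
      ring
  · have h0 := coeff_eq_zero_of_natDegree_lt ((natDegree_legendreP_le n).trans_lt hk)
    cases k <;> simp_all [coeff_derivative]

theorem integral_legendreP_sq (n : ℕ) :
    ∫ x in (-1 : ℝ)..1, (legendreP n).eval x ^ 2 = 2 / (2 * n + 1) := by
  set P := legendreP n
  have htotal : ∫ x in (-1 : ℝ)..1, (derivative (X * P ^ 2)).eval x = 2 := by
    rw [intervalIntegral.integral_eq_sub_of_hasDerivAt (fun x _ => (X * P ^ 2).hasDerivAt x)
      ((derivative _).continuous.intervalIntegrable _ _)]
    simp only [eval_mul, eval_X, eval_pow, P, legendreP_eval_one, legendreP_eval_neg_one]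
    rw [← pow_mul, mul_comm n, pow_mul]
    norm_num
  have hexpand (x : ℝ) : (derivative (X * P ^ 2)).eval x = (2 * n + 1) * P.eval x ^ 2
      + 2 * ((X * derivative P - C (n : ℝ) * P).eval x * P.eval x) := by
    simp [derivative_pow]
    ring
  simp only [hexpand] at htotal
  rw [intervalIntegral.integral_add (Continuous.intervalIntegrable (by fun_prop) _ _)
      (Continuous.intervalIntegrable (by fun_prop) _ _),
    intervalIntegral.integral_const_mul, intervalIntegral.integral_const_mul,
    integral_mul_legendreP_eq_zero (degree_X_mul_derivative_legendreP_sub_lt n)] at htotal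
  rw [eq_div_iff (by positivity)]
  linear_combination htotal

theorem sq_intervalIntegral_mul_le {f g : ℝ → ℝ} (hf : Continuous f) (hg : Continuous g)
    {a b : ℝ} (hab : a ≤ b) :
    (∫ x in a..b, f x * g x) ^ 2 ≤ (∫ x in a..b, f x ^ 2) * ∫ x in a..b, g x ^ 2 := by
  have hquad (t : ℝ) : 0 ≤ (∫ x in a..b, f x ^ 2) * (t * t)
      + 2 * (∫ x in a..b, f x * g x) * t + ∫ x in a..b, g x ^ 2 := by
    calc 0 ≤ ∫ x in a..b, (f x * t + g x) ^ 2 :=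
          intervalIntegral.integral_nonneg hab fun x _ => sq_nonneg _
      _ = ∫ x in a..b, (f x ^ 2 * (t * t) + f x * g x * (2 * t) + g x ^ 2) := by
          congr with x
          ring
      _ = _ := by
          rw [intervalIntegral.integral_add, intervalIntegral.integral_add,
            intervalIntegral.integral_mul_const, intervalIntegral.integral_mul_const]
          · ring
          all_goals exact Continuous.intervalIntegrable (by fun_prop) _ _
  have := discrim_le_zero hquad
  rw [discrim] at this
  linarith

/-- The integral `∫₋₁¹ Pₗ Pₛ Pₙ` of a product of three Legendre polynomials. -/
def legendreTriple (l s n : ℕ) : ℝ :=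
  ∫ x in (-1 : ℝ)..1, (legendreP l).eval x * (legendreP s).eval x * (legendreP n).eval x

theorem legendreTriple_right_comm (l s n : ℕ) : legendreTriple l s n = legendreTriple n s l := by
  unfold legendreTriple
  congr with x
  ring

theorem legendreTriple_eq_zero {l s n : ℕ} (h : l + n < s) : legendreTriple l s n = 0 := by
  have hq : (legendreP l * legendreP n).degree < s := by
    refine degree_le_natDegree.trans_lt (Nat.cast_lt.2 (natDegree_mul_le.trans_lt ?_))
    have := natDegree_legendreP_le l
    have := natDegree_legendreP_le n
    omega
  simpa only [legendreTriple, eval_mul, mul_right_comm]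
    using integral_mul_legendreP_eq_zero hq

theorem integral_legendreP_mul_legendreP_sq_le (s n : ℕ) :
    ∫ x in (-1 : ℝ)..1, ((legendreP s).eval x * (legendreP n).eval x) ^ 2 ≤ 2 / (2 * s + 1) := by
  rw [← integral_legendreP_sq]
  refine intervalIntegral.integral_mono_on (by norm_num)
    (Continuous.intervalIntegrable (by fun_prop) _ _)
    (Continuous.intervalIntegrable (by fun_prop) _ _) fun x hx => ?_
  rw [mul_pow]
  exact mul_le_of_le_one_right (sq_nonneg _)
    ((sq_le_one_iff_abs_le_one _).2 (abs_legendreP_eval_le_one n hx))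

theorem abs_legendreTriple_le (l s n : ℕ) :
    |legendreTriple l s n|
      ≤ 2 * (((s : ℝ) + 1) ^ (-(1 / 2) : ℝ) * ((l : ℝ) + 1) ^ (-(1 / 2) : ℝ)) := by
  have hsq (a : ℕ) : (((a : ℝ) + 1) ^ (-(1 / 2) : ℝ)) ^ 2 = 1 / (a + 1) := by
    rw [← Real.rpow_natCast, ← Real.rpow_mul (by positivity), one_div ((a : ℝ) + 1),
      ← Real.rpow_neg_one]
    norm_num
  have hcs : legendreTriple l s n ^ 2 ≤ 2 / (2 * l + 1) * (2 / (2 * s + 1)) := by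
    simp only [legendreTriple, mul_assoc]
    refine (sq_intervalIntegral_mul_le (legendreP l).continuous
      ((legendreP s).continuous.mul (legendreP n).continuous) (by norm_num)).trans ?_
    rw [integral_legendreP_sq]
    gcongr
    exact integral_legendreP_mul_legendreP_sq_le s n
  refine abs_le_of_sq_le_sq (hcs.trans ?_) (by positivity)
  calc (2 : ℝ) / (2 * l + 1) * (2 / (2 * s + 1)) ≤ 2 / (l + 1) * (2 / (s + 1)) := by
        gcongr <;> linarith [Nat.cast_nonneg (α := ℝ) l, Nat.cast_nonneg (α := ℝ) s]
    _ = _ := by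
        rw [mul_pow, mul_pow, hsq, hsq]
        ring

theorem abs_legendreTriple_le_rpow (l s n : ℕ) {β : ℝ} (hβ0 : 0 ≤ β) (hβ : β ≤ 1 / 2) :
    |legendreTriple l s n|
      ≤ 2 * (((s : ℝ) + 1) ^ (-(1 / 2) : ℝ)
        * (((l : ℝ) + 1) ^ (-β) * ((n : ℝ) + 1) ^ (-(1 / 2 - β)))) := by
  have hsplit (a : ℕ) : ((a : ℝ) + 1) ^ (-(1 / 2) : ℝ)
      = ((a : ℝ) + 1) ^ (-β) * ((a : ℝ) + 1) ^ (-(1 / 2 - β)) := by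
    rw [← Real.rpow_add (by positivity)]
    ring_nf
  rcases le_total n l with h | h
  · refine (abs_legendreTriple_le l s n).trans ?_
    rw [hsplit l]
    gcongr ?_ * (?_ * (?_ * ?_))
    exact Real.rpow_le_rpow_of_nonpos (by positivity) (by gcongr) (by linarith)
  · rw [legendreTriple_right_comm]
    refine (abs_legendreTriple_le n s l).trans ?_
    rw [hsplit n]
    gcongr ?_ * (?_ * (?_ * ?_))
    exact Real.rpow_le_rpow_of_nonpos (by positivity) (by gcongr) (by linarith)

end Legendre

/-! ### Spherical Bessel functions -/

section Bessel

/-- The product `ν(ν+2)⋯(ν+2q-2)`; for `ν = 1` it is the odd double factorial `1·3⋯(2q-1)`. -/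
def stepProd (ν : ℝ) (q : ℕ) : ℝ :=
  ∏ i ∈ Finset.range q, (ν + 2 * (i : ℝ))

theorem stepProd_succ (ν : ℝ) (q : ℕ) : stepProd ν (q + 1) = stepProd ν q * (ν + 2 * q) :=
  Finset.prod_range_succ _ _

theorem stepProd_succ' (ν : ℝ) (q : ℕ) : stepProd ν (q + 1) = ν * stepProd (ν + 2) q := by
  rw [stepProd, Finset.prod_range_succ', mul_comm]
  congr 1
  · simp
  · exact Finset.prod_congr rfl fun i _ => by push_cast; ring

theorem stepProd_pos {ν : ℝ} (hν : 0 < ν) (q : ℕ) : 0 < stepProd ν q :=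
  Finset.prod_pos fun _ _ => by positivity

theorem one_le_abs_stepProd {ν : ℝ} (hν : ∀ i : ℕ, 1 ≤ |ν + 2 * (i : ℝ)|) (q : ℕ) :
    1 ≤ |stepProd ν q| := by
  rw [stepProd, Finset.abs_prod]
  exact Finset.prod_induction _ (1 ≤ ·) (fun _ _ => one_le_mul_of_one_le_of_one_le) le_rfl
    fun i _ => hν i

theorem two_pow_mul_factorial_mul_stepProd_one (q : ℕ) :
    2 ^ q * ((q.factorial : ℝ) * stepProd 1 q) = (2 * q).factorial := by
  induction q with
  | zero => simp [stepProd]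
  | succ q ih =>
    rw [stepProd_succ, Nat.factorial_succ, show 2 * (q + 1) = 2 * q + 1 + 1 by ring,
      Nat.factorial_succ, Nat.factorial_succ]
    push_cast
    rw [← ih]
    ring

theorem two_pow_mul_factorial_mul_stepProd_three (q : ℕ) :
    2 ^ q * ((q.factorial : ℝ) * stepProd 3 q) = (2 * q + 1).factorial := by
  have hshift : stepProd 3 q = stepProd 1 q * (1 + 2 * q) := by
    rw [← stepProd_succ, stepProd_succ', one_mul]
    norm_num
  rw [hshift, Nat.factorial_succ]
  push_cast
  rw [← two_pow_mul_factorial_mul_stepProd_one]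
  ring

/-- The series `∑ z^q / (q! ν(ν+2)⋯(ν+2q-2))` underlying the spherical Bessel functions: at
`z = -x²/2`, `ν = 2n+3` gives `jₙ(x)` and `ν = 1-2n` gives `yₙ(x)`, up to elementary factors. -/
def besselSeries (ν z : ℝ) : ℝ :=
  ∑' q : ℕ, z ^ q / ((q.factorial : ℝ) * stepProd ν q)

theorem norm_besselSeries_term_le {ν : ℝ} (hν : ∀ i : ℕ, 1 ≤ |ν + 2 * (i : ℝ)|) (z : ℝ) (q : ℕ) :
    ‖z ^ q / ((q.factorial : ℝ) * stepProd ν q)‖ ≤ |z| ^ q / (q.factorial : ℝ) := by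
  rw [norm_div, norm_mul, norm_pow, Real.norm_eq_abs, Real.norm_eq_abs, Real.norm_eq_abs,
    Nat.abs_cast]
  gcongr
  exact le_mul_of_one_le_right (by positivity) (one_le_abs_stepProd hν q)

theorem summable_besselSeries {ν : ℝ} (hν : ∀ i : ℕ, 1 ≤ |ν + 2 * (i : ℝ)|) (z : ℝ) :
    Summable fun q : ℕ => z ^ q / ((q.factorial : ℝ) * stepProd ν q) :=
  Summable.of_norm_bounded (Real.summable_pow_div_factorial |z|) (norm_besselSeries_term_le hν z)

theorem abs_besselSeries_le {ν : ℝ} (hν : ∀ i : ℕ, 1 ≤ |ν + 2 * (i : ℝ)|) (z : ℝ) :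
    |besselSeries ν z| ≤ Real.exp |z| := by
  rw [Real.exp_eq_exp_ℝ]
  exact tsum_of_norm_bounded (NormedSpace.expSeries_div_hasSum_exp |z|)
    (norm_besselSeries_term_le hν z)

theorem besselSeries_term_sub {ν : ℝ} (hν : ∀ i : ℕ, 1 ≤ |ν + 2 * (i : ℝ)|) (z : ℝ) (q : ℕ) :
    z ^ (q + 1) / (((q + 1).factorial : ℝ) * stepProd ν (q + 1))
        - z ^ (q + 1) / (((q + 1).factorial : ℝ) * stepProd (ν + 2) (q + 1))
      = 2 * z / (ν * (ν + 2)) * (z ^ q / ((q.factorial : ℝ) * stepProd (ν + 2 + 2) q)) := by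
  have ne_zero {x : ℝ} (hx : 1 ≤ |x|) : x ≠ 0 := abs_pos.1 (zero_lt_one.trans_le hx)
  have hprod : ν * ((ν + 2) * stepProd (ν + 2 + 2) q) ≠ 0 := by
    rw [← stepProd_succ', ← stepProd_succ']
    exact ne_zero (one_le_abs_stepProd hν (q + 2))
  obtain ⟨hν0, hν2, hp⟩ : ν ≠ 0 ∧ ν + 2 ≠ 0 ∧ stepProd (ν + 2 + 2) q ≠ 0 := by
    simpa only [mul_ne_zero_iff] using hprod
  have hlast : ν + 2 + 2 * (q : ℝ) ≠ 0 := by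
    have := ne_zero (hν (q + 1))
    push_cast at this
    rwa [mul_add, mul_one, add_comm (2 * (q : ℝ)), ← add_assoc] at this
  have hshift : stepProd (ν + 2) q = (ν + 2) * stepProd (ν + 2 + 2) q / (ν + 2 + 2 * q) := by
    rw [eq_div_iff hlast, ← stepProd_succ, stepProd_succ']
  rw [stepProd_succ', stepProd_succ' (ν + 2), hshift, Nat.factorial_succ]
  push_cast
  field_simp
  ring

theorem besselSeries_sub {ν : ℝ} (hν : ∀ i : ℕ, 1 ≤ |ν + 2 * (i : ℝ)|) (z : ℝ) :
    besselSeries ν z - besselSeries (ν + 2) z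
      = 2 * z / (ν * (ν + 2)) * besselSeries (ν + 4) z := by
  have hν2 (i : ℕ) : 1 ≤ |ν + 2 + 2 * (i : ℝ)| := by
    convert hν (i + 1) using 2
    push_cast
    ring
  have hs := summable_besselSeries hν z
  have hs2 := summable_besselSeries hν2 z
  rw [besselSeries, besselSeries, ← hs.tsum_sub hs2, (hs.sub hs2).tsum_eq_zero_add]
  simp only [besselSeries_term_sub hν, tsum_mul_left]
  norm_num [stepProd, besselSeries, add_assoc]

theorem one_le_abs_of_odd {a : ℤ} (ha : Odd a) : 1 ≤ |(a : ℝ)| := by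
  rw [← Int.cast_abs]
  exact_mod_cast Int.one_le_abs (by rintro rfl; simp at ha)

theorem one_le_abs_one_sub (n i : ℕ) : 1 ≤ |(1 - 2 * (n : ℝ)) + 2 * (i : ℝ)| := by
  convert one_le_abs_of_odd (odd_two_mul_add_one ((i : ℤ) - n)) using 2
  push_cast
  ring

theorem one_le_abs_add_three (n i : ℕ) : 1 ≤ |(2 * (n : ℝ) + 3) + 2 * (i : ℝ)| := by
  convert one_le_abs_of_odd (odd_two_mul_add_one ((n : ℤ) + 1 + i)) using 2
  push_cast
  ring

theorem besselSeries_one (x : ℝ) : besselSeries 1 (-(x ^ 2 / 2)) = Real.cos x := by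
  rw [← (Real.hasSum_cos x).tsum_eq]
  refine tsum_congr fun q => ?_
  rw [← two_pow_mul_factorial_mul_stepProd_one, neg_pow, div_pow, pow_mul]
  field_simp

theorem mul_besselSeries_three (x : ℝ) : x * besselSeries 3 (-(x ^ 2 / 2)) = Real.sin x := by
  rw [← (Real.hasSum_sin x).tsum_eq, besselSeries, ← tsum_mul_left]
  refine tsum_congr fun q => ?_
  rw [← two_pow_mul_factorial_mul_stepProd_three, neg_pow, div_pow, pow_succ x (2 * q), pow_mul]
  field_simp

theorem prod_range_two_mul_add_one (n : ℕ) :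
    ∏ i ∈ Finset.range n, (2 * (i : ℝ) + 1) = stepProd 1 n :=
  Finset.prod_congr rfl fun _ _ => add_comm _ _

theorem sphericalJ_eq (n : ℕ) (x : ℝ) :
    sphericalJ n x = x ^ n / stepProd 1 (n + 1) * besselSeries (2 * n + 3) (-(x ^ 2 / 2)) := by
  rw [sphericalJ, prod_range_two_mul_add_one]
  rfl

theorem sphericalY_eq (n : ℕ) (x : ℝ) :
    sphericalY n x
      = -(stepProd 1 n / x ^ (n + 1)) * besselSeries (1 - 2 * n) (-(x ^ 2 / 2)) := by
  rw [sphericalY, prod_range_two_mul_add_one]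
  simp only [besselSeries, stepProd, sub_add_eq_add_sub, add_comm (1 : ℝ)]

theorem sphericalJ_add_two (n : ℕ) {x : ℝ} (hx : 0 < x) :
    sphericalJ (n + 2) x = (2 * n + 3) / x * sphericalJ (n + 1) x - sphericalJ n x := by
  have h := besselSeries_sub (one_le_abs_add_three n) (-(x ^ 2 / 2))
  rw [sphericalJ_eq, sphericalJ_eq, sphericalJ_eq, stepProd_succ 1 (n + 2),
    stepProd_succ 1 (n + 1)]
  push_cast
  rw [show 2 * ((n : ℝ) + 2) + 3 = 2 * n + 3 + 4 by ring,
    show 2 * ((n : ℝ) + 1) + 3 = 2 * n + 3 + 2 by ring, sub_eq_iff_eq_add.1 h,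
    show 1 + 2 * ((n : ℝ) + 1) = 2 * n + 3 by ring,
    show 1 + 2 * ((n : ℝ) + 2) = 2 * n + 3 + 2 by ring]
  field_simp
  ring

theorem sphericalY_add_two (n : ℕ) {x : ℝ} (hx : 0 < x) :
    sphericalY (n + 2) x = (2 * n + 3) / x * sphericalY (n + 1) x - sphericalY n x := by
  have h := besselSeries_sub (one_le_abs_one_sub (n + 2)) (-(x ^ 2 / 2))
  rw [sphericalY_eq, sphericalY_eq, sphericalY_eq, stepProd_succ 1 (n + 1), stepProd_succ 1 n]
  push_cast at h ⊢
  rw [show 1 - 2 * ((n : ℝ) + 2) + 2 = 1 - 2 * (n + 1) by ring,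
    show 1 - 2 * ((n : ℝ) + 2) + 4 = 1 - 2 * n by ring, sub_eq_iff_eq_add] at h
  rw [h, show 1 - 2 * ((n : ℝ) + 2) = -(2 * n + 3) by ring,
    show 1 - 2 * ((n : ℝ) + 1) = -(2 * n + 1) by ring]
  field_simp
  ring

theorem sphericalJ_zero {x : ℝ} (hx : 0 < x) : sphericalJ 0 x = Real.sin x / x := by
  rw [← mul_besselSeries_three, sphericalJ_eq]
  norm_num [stepProd]
  field_simp

theorem sphericalY_zero (x : ℝ) : sphericalY 0 x = -(Real.cos x / x) := by
  rw [← besselSeries_one, sphericalY_eq]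
  norm_num [stepProd]
  ring

theorem sphericalJ_one {x : ℝ} (hx : 0 < x) :
    sphericalJ 1 x = Real.sin x / x ^ 2 - Real.cos x / x := by
  have h := besselSeries_sub (ν := 1)
    (fun i => by simpa using one_le_abs_one_sub 0 i) (-(x ^ 2 / 2))
  rw [besselSeries_one] at h
  rw [sub_eq_iff_eq_add.1 h, ← mul_besselSeries_three, sphericalJ_eq]
  norm_num [stepProd, Finset.prod_range_succ]
  field_simp
  ring

theorem sphericalY_one {x : ℝ} (hx : 0 < x) :
    sphericalY 1 x = -(Real.cos x / x ^ 2) - Real.sin x / x := by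
  have h := besselSeries_sub (ν := -1)
    (fun i => by simpa using (one_le_abs_one_sub 1 i).trans_eq (by norm_num)) (-(x ^ 2 / 2))
  norm_num at h
  rw [besselSeries_one, sub_eq_iff_eq_add] at h
  rw [← mul_besselSeries_three, sphericalY_eq]
  norm_num [stepProd, Finset.prod_range_succ]
  rw [h]
  field_simp
  ring

/-- The solution of the Bessel recurrence with both signs made positive, starting from bounds for
`|j₀|, |y₀|` and `|j₁|, |y₁|`. It majorizes `|jₙ|` and `|yₙ|` on `(0, ∞)` and, unlike them, is
decreasing there. -/
def besselMajorant : ℕ → ℝ → ℝ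
  | 0, x => 1 / x
  | 1, x => 1 / x + 1 / x ^ 2
  | n + 2, x => (2 * n + 3) / x * besselMajorant (n + 1) x + besselMajorant n x

theorem besselMajorant_add_two (n : ℕ) (x : ℝ) : besselMajorant (n + 2) x
    = (2 * n + 3) / x * besselMajorant (n + 1) x + besselMajorant n x := rfl

theorem besselMajorant_nonneg (n : ℕ) {x : ℝ} (hx : 0 < x) : 0 ≤ besselMajorant n x := by
  induction n using Nat.twoStepInduction with
  | zero => simp only [besselMajorant]; positivity
  | one => simp only [besselMajorant]; positivity
  | more n h0 h1 => rw [besselMajorant_add_two]; positivity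

theorem antitoneOn_besselMajorant (n : ℕ) : AntitoneOn (besselMajorant n) (Set.Ioi 0) := by
  intro x (hx : 0 < x) y (hy : 0 < y) hxy
  induction n using Nat.twoStepInduction with
  | zero => simp only [besselMajorant]; gcongr
  | one => simp only [besselMajorant]; gcongr
  | more n h0 h1 =>
    rw [besselMajorant_add_two, besselMajorant_add_two]
    have := besselMajorant_nonneg (n + 1) hy
    gcongr

theorem mul_besselMajorant_le_succ (n : ℕ) {x : ℝ} (hx : 0 < x) :
    (2 * n + 1) * besselMajorant n x ≤ x * besselMajorant (n + 1) x := by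
  cases n with
  | zero =>
    simp only [besselMajorant]
    field_simp
    norm_num
    exact hx.le
  | succ n =>
    have := besselMajorant_nonneg n hx
    rw [besselMajorant_add_two, mul_add, ← mul_assoc, mul_div_cancel₀ _ hx.ne']
    push_cast
    nlinarith [mul_nonneg hx.le this]

theorem mul_besselMajorant_add_two_le (n : ℕ) {x : ℝ} (hx : 0 < x) :
    x * besselMajorant (n + 2) x
      ≤ (2 * n + 3) * (1 + x ^ 2 / ((2 * n + 1) * (2 * n + 3))) * besselMajorant (n + 1) x := by
  have hprev : besselMajorant n x ≤ x * besselMajorant (n + 1) x / (2 * n + 1) := by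
    rw [le_div_iff₀' (by positivity)]
    exact mul_besselMajorant_le_succ n hx
  calc x * besselMajorant (n + 2) x
      = (2 * n + 3) * besselMajorant (n + 1) x + x * besselMajorant n x := by
        rw [besselMajorant_add_two]
        field_simp
    _ ≤ (2 * n + 3) * besselMajorant (n + 1) x
          + x * (x * besselMajorant (n + 1) x / (2 * n + 1)) := by gcongr
    _ = _ := by
        field_simp

-- The increments `x²/((2n+1)(2n+3))` telescope to `x²/2`, so the product of the factors in
-- `mul_besselMajorant_add_two_le` is bounded uniformly in `n`.
theorem pow_mul_besselMajorant_succ_le (n : ℕ) {x : ℝ} (hx : 0 < x) :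
    x ^ (n + 2) * besselMajorant (n + 1) x
      ≤ (1 + x) * Real.exp (x ^ 2 / 2 * (1 - 1 / (2 * n + 1))) * stepProd 1 (n + 1) := by
  induction n with
  | zero =>
    refine le_of_eq ?_
    norm_num [besselMajorant, stepProd]
    field_simp
    ring
  | succ n ih =>
    set t : ℝ := x ^ 2 / ((2 * n + 1) * (2 * n + 3)) with ht
    have hexp : x ^ 2 / 2 * (1 - 1 / (2 * ((n + 1 : ℕ) : ℝ) + 1))
        = x ^ 2 / 2 * (1 - 1 / (2 * n + 1)) + t := by
      rw [ht]
      push_cast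
      field_simp
      ring
    have hM := besselMajorant_nonneg (n + 1) hx
    calc x ^ (n + 1 + 2) * besselMajorant (n + 1 + 1) x
        = x ^ (n + 2) * (x * besselMajorant (n + 2) x) := by ring
      _ ≤ x ^ (n + 2) * ((2 * n + 3) * (1 + t) * besselMajorant (n + 1) x) := by
          gcongr ?_ * ?_
          exact mul_besselMajorant_add_two_le n hx
      _ = (1 + t) * (2 * n + 3) * (x ^ (n + 2) * besselMajorant (n + 1) x) := by ring
      _ ≤ Real.exp t * (2 * n + 3) *
            ((1 + x) * Real.exp (x ^ 2 / 2 * (1 - 1 / (2 * n + 1))) * stepProd 1 (n + 1)) := by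
          gcongr
          linarith [Real.add_one_le_exp t]
      _ = _ := by
          rw [hexp, Real.exp_add, stepProd_succ 1 (n + 1)]
          push_cast
          ring

theorem pow_mul_besselMajorant_le (n : ℕ) {x : ℝ} (hx : 0 < x) :
    x ^ (n + 1) * besselMajorant n x ≤ Real.exp (x + x ^ 2 / 2) * stepProd 1 n := by
  cases n with
  | zero =>
    have : x * x⁻¹ = 1 := mul_inv_cancel₀ hx.ne'
    simpa [besselMajorant, stepProd, this] using add_nonneg hx.le (by positivity)
  | succ n =>
    refine (pow_mul_besselMajorant_succ_le n hx).trans ?_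
    have hD := stepProd_pos one_pos (n + 1)
    rw [Real.exp_add]
    gcongr
    · linarith [Real.add_one_le_exp x]
    · have : (0 : ℝ) ≤ 1 / (2 * n + 1) := by positivity
      nlinarith [sq_nonneg x]

theorem abs_le_besselMajorant {x : ℝ} (hx : 0 < x) {f : ℕ → ℝ}
    (hf : ∀ n : ℕ, f (n + 2) = (2 * n + 3) / x * f (n + 1) - f n)
    (h0 : |f 0| ≤ besselMajorant 0 x) (h1 : |f 1| ≤ besselMajorant 1 x) (n : ℕ) :
    |f n| ≤ besselMajorant n x := by
  induction n using Nat.twoStepInduction with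
  | zero => exact h0
  | one => exact h1
  | more n ih0 ih1 =>
    rw [hf, besselMajorant_add_two]
    refine (abs_sub _ _).trans ?_
    rw [abs_mul, abs_of_nonneg (by positivity : 0 ≤ (2 * (n : ℝ) + 3) / x)]
    gcongr

theorem abs_sphericalJ_le_besselMajorant (n : ℕ) {x : ℝ} (hx : 0 < x) :
    |sphericalJ n x| ≤ besselMajorant n x := by
  refine abs_le_besselMajorant (f := fun n => sphericalJ n x) hx
    (fun n => sphericalJ_add_two n hx) ?_ ?_ n
  · rw [sphericalJ_zero hx, abs_div, abs_of_pos hx, besselMajorant]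
    gcongr
    exact Real.abs_sin_le_one x
  · rw [sphericalJ_one hx, besselMajorant, add_comm]
    refine (abs_sub _ _).trans ?_
    rw [abs_div, abs_div, abs_of_pos hx, abs_of_pos (by positivity : 0 < x ^ 2)]
    gcongr
    · exact Real.abs_sin_le_one x
    · exact Real.abs_cos_le_one x

theorem abs_sphericalY_le_besselMajorant (n : ℕ) {x : ℝ} (hx : 0 < x) :
    |sphericalY n x| ≤ besselMajorant n x := by
  refine abs_le_besselMajorant (f := fun n => sphericalY n x) hx
    (fun n => sphericalY_add_two n hx) ?_ ?_ n
  · rw [sphericalY_zero, abs_neg, abs_div, abs_of_pos hx, besselMajorant]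
    gcongr
    exact Real.abs_cos_le_one x
  · rw [sphericalY_one hx, besselMajorant, add_comm]
    refine (abs_sub _ _).trans ?_
    rw [abs_neg, abs_div, abs_div, abs_of_pos hx, abs_of_pos (by positivity : 0 < x ^ 2)]
    gcongr
    · exact Real.abs_cos_le_one x
    · exact Real.abs_sin_le_one x

theorem norm_sphericalH_le_besselMajorant (n : ℕ) {x : ℝ} (hx : 0 < x) :
    ‖sphericalH n x‖ ≤ 2 * besselMajorant n x := by
  refine (norm_add_le _ _).trans ?_
  rw [norm_mul, Complex.norm_I, one_mul, Complex.norm_real, Complex.norm_real, two_mul]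
  exact add_le_add (abs_sphericalJ_le_besselMajorant n hx) (abs_sphericalY_le_besselMajorant n hx)

theorem norm_sphericalH_le_of_le (n : ℕ) {x y : ℝ} (hy : 0 < y) (hyx : y ≤ x) :
    ‖sphericalH n x‖ ≤ 2 * (Real.exp (y + y ^ 2 / 2) * stepProd 1 n / y ^ (n + 1)) := by
  refine (norm_sphericalH_le_besselMajorant n (hy.trans_le hyx)).trans ?_
  gcongr
  refine (antitoneOn_besselMajorant n hy (hy.trans_le hyx) hyx).trans ?_
  rw [le_div_iff₀' (by positivity)]
  exact pow_mul_besselMajorant_le n hy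

theorem abs_sphericalJ_le (n : ℕ) {x : ℝ} (hx : 0 ≤ x) :
    |sphericalJ n x| ≤ x ^ n / stepProd 1 (n + 1) * Real.exp (x ^ 2 / 2) := by
  have h := abs_besselSeries_le (one_le_abs_add_three n) (-(x ^ 2 / 2))
  have := stepProd_pos one_pos (n + 1)
  rw [abs_neg, abs_of_nonneg (by positivity : 0 ≤ x ^ 2 / 2)] at h
  rw [sphericalJ_eq, abs_mul, abs_of_nonneg (by positivity : 0 ≤ x ^ n / stepProd 1 (n + 1))]
  gcongr

theorem norm_sphericalH_mul_sphericalJ_le {κ R : ℝ} (hκ : 0 < κ) (n : ℕ) {a ρ : ℝ} (ha : 0 ≤ a)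
    (hρ : 0 < ρ) (hρR : ρ ≤ R) :
    ‖sphericalH n (κ * max a ρ) * (sphericalJ n (κ * min a ρ) : ℂ)‖
      ≤ 2 * Real.exp (κ * R + (κ * R) ^ 2) / (κ * (2 * n + 1)) *
        (min (min a R) ρ ^ n / max (min a R) ρ ^ (n + 1)) := by
  set M := max (min a R) ρ
  set μ := min (min a R) ρ with hμ
  have hμ_eq : min a ρ = μ := by rw [hμ, min_assoc, min_eq_right hρR]
  have hR : 0 < R := hρ.trans_le hρR
  have hM0 : 0 < M := hρ.trans_le (le_max_right _ _)
  have hMR : M ≤ R := max_le (min_le_right _ _) hρR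
  have hμR : μ ≤ R := (min_le_right _ _).trans hρR
  have hH : ‖sphericalH n (κ * max a ρ)‖
      ≤ 2 * (Real.exp (κ * R + (κ * R) ^ 2 / 2) * stepProd 1 n / (κ * M) ^ (n + 1)) := by
    refine (norm_sphericalH_le_of_le n (mul_pos hκ hM0)
      (mul_le_mul_of_nonneg_left (max_le_max_right ρ (min_le_left a R)) hκ.le)).trans ?_
    have := stepProd_pos one_pos n
    gcongr
  have hJ : ‖(sphericalJ n (κ * min a ρ) : ℂ)‖
      ≤ (κ * μ) ^ n / stepProd 1 (n + 1) * Real.exp ((κ * R) ^ 2 / 2) := by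
    rw [Complex.norm_real, Real.norm_eq_abs, hμ_eq]
    refine (abs_sphericalJ_le n (by positivity)).trans ?_
    have := stepProd_pos one_pos (n + 1)
    gcongr
  have hD := stepProd_pos one_pos n
  have hexp : Real.exp (κ * R + (κ * R) ^ 2)
      = Real.exp (κ * R + (κ * R) ^ 2 / 2) * Real.exp ((κ * R) ^ 2 / 2) := by
    rw [← Real.exp_add, add_assoc, add_halves]
  rw [norm_mul]
  refine (mul_le_mul hH hJ (norm_nonneg _) (by positivity)).trans_eq ?_
  rw [hexp, stepProd_succ, mul_pow, mul_pow]
  field_simp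
  ring

end Bessel

/-! ### The radial integral -/

section Radial

theorem sq_mul_min_pow_div_max_pow_le {R b ρ : ℝ} (hb : 0 ≤ b) (hbR : b ≤ R) (hρ : 0 < ρ)
    (hρR : ρ ≤ R) (n : ℕ) :
    ρ ^ 2 * (min b ρ ^ n / max b ρ ^ (n + 1)) ≤ R * (1 - |ρ - b| / R) ^ n := by
  have hR : 0 < R := hρ.trans_le hρR
  have hmax : 0 < max b ρ := hρ.trans_le (le_max_right _ _)
  have hmaxR : max b ρ ≤ R := max_le hbR hρR
  have hratio : min b ρ / max b ρ ≤ 1 - |ρ - b| / R := by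
    have hdiff : min b ρ = max b ρ - |ρ - b| := by linarith [max_sub_min_eq_abs b ρ]
    rw [hdiff, sub_div, div_self hmax.ne']
    gcongr
  have hprefactor : ρ ^ 2 / max b ρ ≤ R := by
    rw [div_le_iff₀ hmax, sq]
    exact mul_le_mul hρR (le_max_right _ _) hρ.le hR.le
  calc ρ ^ 2 * (min b ρ ^ n / max b ρ ^ (n + 1))
      = (ρ ^ 2 / max b ρ) * (min b ρ / max b ρ) ^ n := by
        rw [div_pow]
        field_simp
        ring
    _ ≤ R * (1 - |ρ - b| / R) ^ n := by gcongr

theorem integral_comp_abs_sub_le {f : ℝ → ℝ} (hf : Continuous f) {b R : ℝ} (hb : 0 ≤ b)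
    (hbR : b ≤ R) (hf0 : ∀ t ∈ Set.Icc 0 R, 0 ≤ f t) :
    ∫ ρ in (0 : ℝ)..R, f |ρ - b| ≤ 2 * ∫ t in (0 : ℝ)..R, f t := by
  have hmono {c : ℝ} (hc : 0 ≤ c) (hcR : c ≤ R) : ∫ t in (0 : ℝ)..c, f t ≤ ∫ t in (0 : ℝ)..R, f t :=
    intervalIntegral.integral_mono_interval le_rfl hc hcR
      ((ae_restrict_iff' measurableSet_Ioc).2
        (.of_forall fun t ht => hf0 t (Set.Ioc_subset_Icc_self ht)))
      (hf.intervalIntegrable 0 R)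
  have hleft : ∫ ρ in (0 : ℝ)..b, f |ρ - b| = ∫ t in (0 : ℝ)..b, f t := by
    have hreflect := intervalIntegral.integral_comp_sub_left f b (a := 0) (b := b)
    rw [sub_self, sub_zero] at hreflect
    rw [← hreflect]
    refine intervalIntegral.integral_congr fun ρ hρ => ?_
    rw [Set.uIcc_of_le hb] at hρ
    simp only [abs_of_nonpos (sub_nonpos.2 hρ.2), neg_sub]
  have hright : ∫ ρ in b..R, f |ρ - b| = ∫ t in (0 : ℝ)..(R - b), f t := by
    rw [← sub_self b, ← intervalIntegral.integral_comp_sub_right]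
    refine intervalIntegral.integral_congr fun ρ hρ => ?_
    rw [Set.uIcc_of_le hbR] at hρ
    simp only [abs_of_nonneg (sub_nonneg.2 hρ.1)]
  have hc : Continuous fun ρ : ℝ => f |ρ - b| := by fun_prop
  rw [← intervalIntegral.integral_add_adjacent_intervals (hc.intervalIntegrable 0 b)
    (hc.intervalIntegrable b R), hleft, hright, two_mul]
  exact add_le_add (hmono hb hbR) (hmono (sub_nonneg.2 hbR) (sub_le_self R hb))

theorem integral_one_sub_div_pow {R : ℝ} (hR : R ≠ 0) (n : ℕ) :
    ∫ t in (0 : ℝ)..R, (1 - t / R) ^ n = R / (n + 1) := by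
  rw [intervalIntegral.integral_comp_sub_div (fun x => x ^ n) hR]
  simp [hR, integral_pow, div_eq_mul_inv]

theorem norm_greenKernel_mul_le {κ R : ℝ} (hκ : 0 < κ) (n : ℕ) {a ρ S : ℝ} {w : ℂ} (ha : 0 ≤ a)
    (hρ : ρ ∈ Set.Ioc 0 R) (hw : ‖w‖ ≤ S) :
    ‖sphericalH n (κ * max a ρ) * (sphericalJ n (κ * min a ρ) : ℂ) * w * (ρ : ℂ) ^ 2‖
      ≤ 2 * Real.exp (κ * R + (κ * R) ^ 2) / (κ * (2 * n + 1)) * S * R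
        * (1 - |ρ - min a R| / R) ^ n := by
  have hb0 : 0 ≤ min a R := le_min ha (hρ.1.le.trans hρ.2)
  have hmin : 0 ≤ min (min a R) ρ := le_min hb0 hρ.1.le
  have hmax : 0 < max (min a R) ρ := hρ.1.trans_le (le_max_right _ _)
  have hS : 0 ≤ S := (norm_nonneg w).trans hw
  rw [norm_mul, norm_mul _ w, norm_pow, Complex.norm_real, Real.norm_eq_abs, abs_of_pos hρ.1]
  set C := 2 * Real.exp (κ * R + (κ * R) ^ 2) / (κ * (2 * n + 1))
  calc _ ≤ C * (min (min a R) ρ ^ n / max (min a R) ρ ^ (n + 1)) * S * ρ ^ 2 := by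
        gcongr
        exact norm_sphericalH_mul_sphericalJ_le hκ n ha hρ.1 hρ.2
    _ = C * S * (ρ ^ 2 * (min (min a R) ρ ^ n / max (min a R) ρ ^ (n + 1))) := by ring
    _ ≤ C * S * (R * (1 - |ρ - min a R| / R) ^ n) := by
        gcongr ?_ * ?_
        exact sq_mul_min_pow_div_max_pow_le hb0 (min_le_right _ _) hρ.1 hρ.2 n
    _ = _ := by ring

theorem norm_radialOperator_le {κ R : ℝ} (hκ : 0 < κ) (hR : 0 < R) (M v : ℝ → ℝ → ℂ) (n : ℕ)
    {a S : ℝ} (ha : 0 ≤ a) (hS : ∀ ρ ∈ Set.Ioc 0 R, ‖angularIntegral M v n ρ‖ ≤ S) :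
    ‖radialOperator κ R M n v a‖
      ≤ 4 * κ ^ 2 * R ^ 2 * Real.exp (κ * R + (κ * R) ^ 2) * (S / (n + 1)) := by
  have hS0 : 0 ≤ S := (norm_nonneg _).trans (hS R ⟨hR, le_rfl⟩)
  have hprofile : ∫ ρ in (0 : ℝ)..R, (1 - |ρ - min a R| / R) ^ n ≤ 2 * (R / (n + 1)) := by
    rw [← integral_one_sub_div_pow hR.ne']
    refine integral_comp_abs_sub_le (f := fun t => (1 - t / R) ^ n) (by fun_prop)
      (le_min ha hR.le) (min_le_right _ _) fun t ht => ?_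
    exact pow_nonneg (sub_nonneg.2 ((div_le_one hR).2 ht.2)) n
  have hint := intervalIntegral.norm_integral_le_of_norm_le (μ := volume) hR.le
    (.of_forall fun ρ hρ => norm_greenKernel_mul_le hκ n ha hρ (hS ρ hρ))
    (Continuous.intervalIntegrable (by fun_prop) _ _)
  rw [intervalIntegral.integral_const_mul] at hint
  have hcoef : ‖-((2 * (n : ℂ) + 1) * (κ : ℂ) ^ 3)‖ = (2 * n + 1) * κ ^ 3 := by
    rw [norm_neg]
    exact_mod_cast Complex.norm_of_nonneg (by positivity : (0 : ℝ) ≤ (2 * n + 1) * κ ^ 3)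
  rw [radialOperator, norm_mul, hcoef]
  calc _ ≤ (2 * n + 1) * κ ^ 3 * (2 * Real.exp (κ * R + (κ * R) ^ 2) / (κ * (2 * n + 1)) * S * R
          * (2 * (R / (n + 1)))) := by
        gcongr
        exact hint.trans (by gcongr)
    _ = _ := by
        field_simp
        ring

end Radial

/-! ### The angular integral -/

section Angular

theorem norm_legendreP_cos_le (n : ℕ) (θ : ℝ) :
    ‖(((legendreP n).eval (Real.cos θ) : ℝ) : ℂ)‖ ≤ 1 := by
  rw [Complex.norm_real, Real.norm_eq_abs]
  exact abs_legendreP_eval_le_one n ⟨Real.neg_one_le_cos θ, Real.cos_le_one θ⟩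

theorem norm_mul_legendreP_cos_le (c : ℂ) (n : ℕ) (θ : ℝ) :
    ‖c * (((legendreP n).eval (Real.cos θ) : ℝ) : ℂ)‖ ≤ ‖c‖ := by
  rw [norm_mul]
  exact mul_le_of_le_one_right (norm_nonneg _) (norm_legendreP_cos_le n θ)

theorem integral_comp_cos_mul_sin {f : ℝ → ℝ} (hf : Continuous f) :
    ∫ θ in (0 : ℝ)..Real.pi, f (Real.cos θ) * Real.sin θ = ∫ x in (-1 : ℝ)..1, f x := by
  have h := intervalIntegral.integral_comp_mul_deriv (a := 0) (b := Real.pi) (g := f)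
    (fun x _ => Real.hasDerivAt_cos x) (by fun_prop) hf
  rw [Real.cos_zero, Real.cos_pi, intervalIntegral.integral_symm (-1) 1] at h
  rw [← neg_inj, ← h, ← intervalIntegral.integral_neg]
  simp

theorem hasSum_legendreTail_mul_legendreSeries {m u : ℕ → ℝ → ℂ} {F : ℕ} {ρ : ℝ}
    (hm : Summable fun l => ‖m l ρ‖) (hu : Summable fun i => ‖u (F + 1 + i) ρ‖) (θ : ℝ) :
    HasSum (fun z : ℕ × ℕ =>
        u (F + 1 + z.1) ρ * (((legendreP (F + 1 + z.1)).eval (Real.cos θ) : ℝ) : ℂ)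
          * (m z.2 ρ * (((legendreP z.2).eval (Real.cos θ) : ℝ) : ℂ)))
      (legendreTail u F ρ θ * legendreSeries m ρ θ) := by
  have hu' : Summable fun i =>
      ‖u (F + 1 + i) ρ * (((legendreP (F + 1 + i)).eval (Real.cos θ) : ℝ) : ℂ)‖ :=
    .of_nonneg_of_le (fun _ => norm_nonneg _) (fun _ => norm_mul_legendreP_cos_le _ _ θ) hu
  have hm' : Summable fun l => ‖m l ρ * (((legendreP l).eval (Real.cos θ) : ℝ) : ℂ)‖ :=
    .of_nonneg_of_le (fun _ => norm_nonneg _) (fun _ => norm_mul_legendreP_cos_le _ _ θ) hm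
  rw [legendreTail, legendreSeries, tsum_mul_tsum_of_summable_norm hu' hm']
  exact (summable_mul_of_summable_norm hu' hm').hasSum

theorem integral_legendreP_cos_triple (c d : ℂ) (l s n : ℕ) :
    ∫ θ in (0 : ℝ)..Real.pi, d * (((legendreP s).eval (Real.cos θ) : ℝ) : ℂ)
          * (c * (((legendreP l).eval (Real.cos θ) : ℝ) : ℂ))
          * (((legendreP n).eval (Real.cos θ) : ℝ) : ℂ) * ((Real.sin θ : ℝ) : ℂ)
      = d * c * (legendreTriple l s n : ℂ) := by
  rw [legendreTriple, ← integral_comp_cos_mul_sin (by fun_prop), ← intervalIntegral.integral_ofReal,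
    ← intervalIntegral.integral_const_mul]
  congr with θ
  push_cast
  ring

theorem hasSum_angularIntegral {m u : ℕ → ℝ → ℂ} {F : ℕ} {ρ : ℝ} (hm : Summable fun l => ‖m l ρ‖)
    (hu : Summable fun i => ‖u (F + 1 + i) ρ‖) (n : ℕ) :
    HasSum (fun z : ℕ × ℕ =>
        u (F + 1 + z.1) ρ * m z.2 ρ * (legendreTriple z.2 (F + 1 + z.1) n : ℂ))
      (angularIntegral (legendreSeries m) (legendreTail u F) n ρ) := by
  simp only [← integral_legendreP_cos_triple, angularIntegral]
  refine intervalIntegral.hasSum_integral_of_dominated_convergence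
    (fun z _ => ‖u (F + 1 + z.1) ρ‖ * ‖m z.2 ρ‖)
    (fun z => Continuous.aestronglyMeasurable (by fun_prop))
    (fun z => .of_forall fun θ _ => ?_)
    (.of_forall fun θ _ => hu.mul_of_nonneg hm (fun _ => norm_nonneg _) fun _ => norm_nonneg _)
    intervalIntegrable_const
    (.of_forall fun θ _ =>
      ((hasSum_legendreTail_mul_legendreSeries hm hu θ).mul_right _).mul_right _)
  have hsin : ‖((Real.sin θ : ℝ) : ℂ)‖ ≤ 1 := by
    rw [Complex.norm_real]
    exact Real.abs_sin_le_one θ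
  rw [norm_mul, norm_mul, norm_mul (u _ _ * _)]
  refine (mul_le_of_le_one_right (by positivity) hsin).trans
    ((mul_le_of_le_one_right (by positivity) (norm_legendreP_cos_le n θ)).trans ?_)
  gcongr <;> exact norm_mul_legendreP_cos_le _ _ θ

end Angular

/-! ### Power sums -/

section PowerSums

theorem sum_add_rpow_le {q : ℝ} (hq : 0 < q) {d : ℕ} (hd : 1 ≤ d) (N : ℕ) :
    ∑ i ∈ Finset.range N, ((d : ℝ) + i) ^ (-(1 + q)) ≤ (1 + 1 / q) * (d : ℝ) ^ (-q) := by
  rcases N with _ | N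
  · rw [Finset.range_zero, Finset.sum_empty]
    positivity
  have hd1 : (1 : ℝ) ≤ d := by exact_mod_cast hd
  have hd0 : (0 : ℝ) < d := one_pos.trans_le hd1
  have hanti : AntitoneOn (fun x : ℝ => x ^ (-(1 + q))) (Set.Icc (d : ℝ) (d + N)) :=
    fun x hx y _ hxy =>
      Real.rpow_le_rpow_of_nonpos (hd0.trans_le hx.1) hxy (by linarith)
  have hintegral : ∫ x in (d : ℝ)..(d + N), x ^ (-(1 + q)) ≤ 1 / q * (d : ℝ) ^ (-q) := by
    have hnotMem : (0 : ℝ) ∉ Set.uIcc (d : ℝ) (d + N) := by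
      rw [Set.uIcc_of_le (by simp)]
      exact fun h => hd0.not_ge h.1
    rw [integral_rpow (.inr ⟨by linarith, hnotMem⟩), show -(1 + q) + 1 = -q by ring, div_neg,
      ← neg_div, neg_sub, div_eq_inv_mul, one_div]
    gcongr
    exact sub_le_self _ (by positivity)
  rw [Finset.sum_range_succ', add_mul, one_mul, add_comm, Nat.cast_zero, add_zero]
  exact add_le_add (Real.rpow_le_rpow_of_exponent_le hd1 (by linarith))
    (hanti.sum_le_integral.trans hintegral)

theorem summable_add_rpow {q : ℝ} (hq : 0 < q) {d : ℕ} (hd : 1 ≤ d) :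
    Summable fun i : ℕ => ((d : ℝ) + i) ^ (-(1 + q)) :=
  summable_of_sum_range_le (fun _ => by positivity) (sum_add_rpow_le hq hd)

theorem tsum_le_of_eq_zero_of_le_rpow {q K : ℝ} (hq : 0 < q) (hK : 0 ≤ K) {d : ℕ} (hd : 1 ≤ d)
    {f : ℕ → ℝ} (hf : Summable f) (hzero : ∀ l < d, f l = 0)
    (hle : ∀ l, d ≤ l → f l ≤ K * (l : ℝ) ^ (-(1 + q))) :
    ∑' l, f l ≤ K * ((1 + 1 / q) * (d : ℝ) ^ (-q)) := by
  rw [← hf.sum_add_tsum_nat_add d,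
    Finset.sum_eq_zero fun l hl => hzero l (Finset.mem_range.1 hl), zero_add]
  have hshift (i : ℕ) : f (i + d) ≤ K * ((d : ℝ) + i) ^ (-(1 + q)) := by
    simpa only [Nat.cast_add, add_comm (i : ℝ)] using hle _ (Nat.le_add_left d i)
  calc ∑' i, f (i + d) ≤ ∑' i : ℕ, K * ((d : ℝ) + i) ^ (-(1 + q)) :=
        ((summable_nat_add_iff d).2 hf).tsum_le_tsum hshift ((summable_add_rpow hq hd).mul_left K)
    _ ≤ _ := by
        rw [tsum_mul_left]
        gcongr
        exact (summable_add_rpow hq hd).tsum_le_of_sum_range_le (sum_add_rpow_le hq hd)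

theorem tsum_prod_le_of_eq_zero_of_le_rpow {q K : ℝ} (hq : 0 < q) (hK : 0 ≤ K) {d : ℕ}
    (hd : 1 ≤ d) {f : ℕ × ℕ → ℝ} (hf : Summable f) (hzero : ∀ i, ∀ l < d + i, f (i, l) = 0)
    (hle : ∀ i l, d + i ≤ l → f (i, l) ≤ K * (l : ℝ) ^ (-(2 + q))) :
    ∑' z, f z ≤ (1 + 1 / (1 + q)) * (1 + 1 / q) * K * (d : ℝ) ^ (-q) := by
  have hinner (i : ℕ) :
      ∑' l, f (i, l) ≤ K * (1 + 1 / (1 + q)) * ((d : ℝ) + i) ^ (-(1 + q)) := by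
    have h := tsum_le_of_eq_zero_of_le_rpow (q := 1 + q) (by positivity) hK
      (hd.trans (Nat.le_add_right d i)) (hf.prod_factor i) (hzero i) fun l hl => by
        rw [← add_assoc, one_add_one_eq_two]
        exact hle i l hl
    rwa [Nat.cast_add, ← mul_assoc] at h
  have hsummable := summable_add_rpow hq hd
  rw [hf.tsum_prod]
  calc ∑' i, ∑' l, f (i, l)
      ≤ ∑' i : ℕ, K * (1 + 1 / (1 + q)) * ((d : ℝ) + i) ^ (-(1 + q)) :=
        hf.prod.tsum_le_tsum hinner (hsummable.mul_left _)
    _ ≤ K * (1 + 1 / (1 + q)) * ((1 + 1 / q) * (d : ℝ) ^ (-q)) := by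
        rw [tsum_mul_left]
        gcongr
        exact hsummable.tsum_le_of_sum_range_le (sum_add_rpow_le hq hd)
    _ = _ := by ring

theorem sum_succ_rpow_le {p : ℝ} (hp : 1 < p) (N : ℕ) :
    ∑ n ∈ Finset.range N, ((n : ℝ) + 1) ^ (-p) ≤ 1 + 1 / (p - 1) := by
  simpa [add_comm] using sum_add_rpow_le (sub_pos.2 hp) le_rfl N

theorem sum_succ_inv_le_log {F : ℕ} (hF : 2 ≤ F) :
    ∑ n ∈ Finset.range (F + 1), ((n : ℝ) + 1)⁻¹ ≤ 4 * Real.log F := by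
  have hF2 : (2 : ℝ) ≤ F := by exact_mod_cast hF
  have hharmonic := harmonic_le_one_add_log (F + 1)
  have hsucc : Real.log ((F + 1 : ℕ) : ℝ) ≤ 2 * Real.log F := by
    rw [← Real.log_rpow (by positivity), Real.rpow_two]
    refine Real.log_le_log (by positivity) ?_
    push_cast
    nlinarith
  have hlog : 1 / 2 ≤ Real.log F :=
    (by linarith [Real.log_two_gt_d9] : 1 / 2 ≤ Real.log 2).trans
      (Real.log_le_log two_pos hF2)
  simp only [harmonic, Rat.cast_sum, Rat.cast_inv, Nat.cast_add, Nat.cast_one, Rat.cast_add,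
    Rat.cast_natCast, Rat.cast_one] at hharmonic hsucc
  linarith

theorem sum_succ_rpow_le_log {μ : ℝ} (hμ : μ ≤ 1) {F : ℕ} (hF : 2 ≤ F) :
    ∑ n ∈ Finset.range (F + 1), ((n : ℝ) + 1) ^ (-μ)
      ≤ ((F : ℝ) + 1) ^ (1 - μ) * (4 * Real.log F) := by
  refine le_trans ?_ (mul_le_mul_of_nonneg_left (sum_succ_inv_le_log hF) (by positivity))
  rw [Finset.mul_sum]
  refine Finset.sum_le_sum fun n hn => ?_
  have hnF : (n : ℝ) ≤ F := by exact_mod_cast Finset.mem_range_succ_iff.1 hn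
  calc ((n : ℝ) + 1) ^ (-μ) = ((n : ℝ) + 1) ^ (1 - μ) * ((n : ℝ) + 1)⁻¹ := by
        rw [← Real.rpow_neg_one, ← Real.rpow_add (by positivity)]
        ring_nf
    _ ≤ ((F : ℝ) + 1) ^ (1 - μ) * ((n : ℝ) + 1)⁻¹ := by
        gcongr

/-- The convolution `∑_{i + j = F} (i + 1)^(-p) (j + 1)^(-q)` of two power sequences, shifted so
that both start at `1`. -/
def powerConvolution (p q : ℝ) (F : ℕ) : ℝ :=
  ∑ z ∈ Finset.HasAntidiagonal.antidiagonal F, ((z.1 : ℝ) + 1) ^ (-p) * ((z.2 : ℝ) + 1) ^ (-q)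

theorem powerConvolution_le {p q : ℝ} (hp : 0 ≤ p) (hq : 0 ≤ q) {F : ℕ} (hF : 1 ≤ F) :
    powerConvolution p q F
      ≤ ((F : ℝ) / 2) ^ (-p) * ∑ n ∈ Finset.range (F + 1), ((n : ℝ) + 1) ^ (-q)
        + ((F : ℝ) / 2) ^ (-q) * ∑ n ∈ Finset.range (F + 1), ((n : ℝ) + 1) ^ (-p) := by
  have hfst (r : ℝ) : ∑ n ∈ Finset.range (F + 1), ((n : ℝ) + 1) ^ (-r)
      = ∑ z ∈ Finset.HasAntidiagonal.antidiagonal F, ((z.1 : ℝ) + 1) ^ (-r) := by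
    rw [Finset.Nat.sum_antidiagonal_eq_sum_range_succ_mk]
  rw [hfst p, hfst q, ← Finset.Nat.sum_antidiagonal_swap (f := fun z => ((z.1 : ℝ) + 1) ^ (-q)),
    Finset.mul_sum, Finset.mul_sum, ← Finset.sum_add_distrib]
  refine Finset.sum_le_sum fun z hz => ?_
  have hz : (z.1 : ℝ) + z.2 = F := by
    exact_mod_cast Finset.HasAntidiagonal.mem_antidiagonal.1 hz
  rw [Prod.fst_swap]
  rcases le_total ((F : ℝ) / 2) (z.1 + 1) with hlarge | hsmall
  · refine le_add_of_le_of_nonneg ?_ (by positivity)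
    gcongr ?_ * _
    exact Real.rpow_le_rpow_of_nonpos (by positivity) hlarge (neg_nonpos.2 hp)
  · refine le_add_of_nonneg_of_le (by positivity) ?_
    rw [mul_comm]
    gcongr ?_ * _
    exact Real.rpow_le_rpow_of_nonpos (by positivity) (by linarith) (neg_nonpos.2 hq)

theorem div_two_rpow_le {p r : ℝ} (hr : r ≤ p) {F : ℕ} (hF : 1 ≤ F) :
    ((F : ℝ) / 2) ^ (-p) ≤ 2 ^ p * (F : ℝ) ^ (-r) := by
  have hF1 : (1 : ℝ) ≤ F := by exact_mod_cast hF
  rw [Real.div_rpow (by positivity) (by norm_num), Real.rpow_neg (by norm_num : (0 : ℝ) ≤ 2),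
    div_inv_eq_mul, mul_comm]
  gcongr

theorem exists_powerConvolution_le_rpow {p q : ℝ} (hp : 1 < p) (hq : 1 < q) :
    ∃ C : ℝ, 0 < C ∧ ∀ F : ℕ, 1 ≤ F → powerConvolution p q F ≤ C * (F : ℝ) ^ (-min p q) := by
  refine ⟨2 ^ p * (1 + 1 / (q - 1)) + 2 ^ q * (1 + 1 / (p - 1)), by positivity, fun F hF => ?_⟩
  calc _ ≤ ((F : ℝ) / 2) ^ (-p) * ∑ n ∈ Finset.range (F + 1), ((n : ℝ) + 1) ^ (-q)
        + ((F : ℝ) / 2) ^ (-q) * ∑ n ∈ Finset.range (F + 1), ((n : ℝ) + 1) ^ (-p) :=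
        powerConvolution_le (by linarith) (by linarith) hF
    _ ≤ (2 ^ p * (F : ℝ) ^ (-min p q)) * (1 + 1 / (q - 1))
        + (2 ^ q * (F : ℝ) ^ (-min p q)) * (1 + 1 / (p - 1)) := by
        gcongr
        · exact div_two_rpow_le (min_le_left _ _) hF
        · exact sum_succ_rpow_le hq _
        · exact div_two_rpow_le (min_le_right _ _) hF
        · exact sum_succ_rpow_le hp _
    _ = _ := by ring

theorem rpow_neg_one_mul_succ_rpow_le {μ : ℝ} (hμ0 : 0 ≤ μ) (hμ : μ ≤ 1) {F : ℕ} (hF : 1 ≤ F) :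
    (F : ℝ) ^ (-1 : ℝ) * ((F : ℝ) + 1) ^ (1 - μ) ≤ 2 * (F : ℝ) ^ (-μ) := by
  have hF1 : (1 : ℝ) ≤ F := by exact_mod_cast hF
  have htwo : (2 : ℝ) ^ (1 - μ) ≤ 2 := by
    simpa using Real.rpow_le_rpow_of_exponent_le one_le_two (sub_le_self 1 hμ0)
  calc (F : ℝ) ^ (-1 : ℝ) * ((F : ℝ) + 1) ^ (1 - μ)
      ≤ (F : ℝ) ^ (-1 : ℝ) * (2 * (F : ℝ)) ^ (1 - μ) := by
        gcongr
        linarith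
    _ = 2 ^ (1 - μ) * (F : ℝ) ^ (-μ) := by
        rw [Real.mul_rpow two_pos.le (by positivity), mul_left_comm,
          ← Real.rpow_add (by positivity)]
        ring_nf
    _ ≤ 2 * (F : ℝ) ^ (-μ) := by gcongr

theorem exists_powerConvolution_one_le_log {q : ℝ} (hq : 0 ≤ q) :
    ∃ C : ℝ, 0 < C ∧ ∀ F : ℕ, 2 ≤ F →
      powerConvolution 1 q F ≤ C * (Real.log F * (F : ℝ) ^ (-min 1 q)) := by
  refine ⟨16 + 4 * 2 ^ q, by positivity, fun F hF => ?_⟩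
  have hF1 : 1 ≤ F := one_le_two.trans hF
  set μ := min 1 q
  have hμ0 : 0 ≤ μ := le_min zero_le_one hq
  have hμ1 : μ ≤ 1 := min_le_left _ _
  have hsum : ∑ n ∈ Finset.range (F + 1), ((n : ℝ) + 1) ^ (-q)
      ≤ ((F : ℝ) + 1) ^ (1 - μ) * (4 * Real.log F) := by
    refine le_trans ?_ (sum_succ_rpow_le_log hμ1 hF)
    gcongr with n
    · simp
    · exact min_le_right _ _
  have hinv : ∑ n ∈ Finset.range (F + 1), ((n : ℝ) + 1) ^ (-1 : ℝ) ≤ 4 * Real.log F := by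
    simpa only [Real.rpow_neg_one] using sum_succ_inv_le_log hF
  calc powerConvolution 1 q F
      ≤ _ := powerConvolution_le zero_le_one hq hF1
    _ ≤ (2 ^ (1 : ℝ) * (F : ℝ) ^ (-1 : ℝ)) * (((F : ℝ) + 1) ^ (1 - μ) * (4 * Real.log F))
        + (2 ^ q * (F : ℝ) ^ (-μ)) * (4 * Real.log F) := by
        gcongr
        · exact div_two_rpow_le le_rfl hF1
        · exact div_two_rpow_le (min_le_right _ _) hF1
    _ = 8 * Real.log F * ((F : ℝ) ^ (-1 : ℝ) * ((F : ℝ) + 1) ^ (1 - μ))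
        + 4 * 2 ^ q * (Real.log F * (F : ℝ) ^ (-μ)) := by
        rw [Real.rpow_one]
        ring
    _ ≤ 8 * Real.log F * (2 * (F : ℝ) ^ (-μ)) + 4 * 2 ^ q * (Real.log F * (F : ℝ) ^ (-μ)) := by
        gcongr _ * ?_ + _
        exact rpow_neg_one_mul_succ_rpow_le hμ0 hμ1 hF1
    _ = _ := by ring

end PowerSums

/-! ### The truncated operator -/

section Operator

/-- `CoeffDecay R A p c`: the functions `c l`, `l ≥ 1`, decay like `A l ^ (-p)` uniformly on
`[0, R]`. Nothing is asked of `c 0`. -/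
def CoeffDecay (R A p : ℝ) (c : ℕ → ℝ → ℂ) : Prop :=
  ∀ l : ℕ, 1 ≤ l → ∀ ρ ∈ Set.Icc 0 R, ‖c l ρ‖ ≤ A * (l : ℝ) ^ (-p)

variable {R A B p γ β ρ : ℝ} {c m u : ℕ → ℝ → ℂ} {F n : ℕ}

theorem CoeffDecay.nonneg (hc : CoeffDecay R A p c) (hR : 0 ≤ R) : 0 ≤ A := by
  simpa using (norm_nonneg _).trans (hc 1 le_rfl 0 ⟨le_rfl, hR⟩)

theorem CoeffDecay.summable_norm_add (hc : CoeffDecay R A p c) (hp : 1 < p)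
    (hρ : ρ ∈ Set.Icc 0 R) (d : ℕ) : Summable fun i => ‖c (d + 1 + i) ρ‖ := by
  have hpower := (summable_add_rpow (sub_pos.2 hp) (Nat.le_add_left 1 d)).mul_left A
  refine .of_nonneg_of_le (fun _ => norm_nonneg _) (fun i => hc _ (by omega) ρ hρ)
    (hpower.congr fun i => ?_)
  push_cast
  ring_nf

theorem CoeffDecay.summable_norm (hc : CoeffDecay R A p c) (hp : 1 < p)
    (hρ : ρ ∈ Set.Icc 0 R) : Summable fun l => ‖c l ρ‖ := by
  simpa only [zero_add, add_comm 1, summable_nat_add_iff 1 (f := fun l => ‖c l ρ‖)] using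
    hc.summable_norm_add hp hρ 0

theorem rpow_mul_succ_rpow_le {x q : ℝ} (hx : 0 < x) (p : ℝ) (hq : 0 ≤ q) :
    x ^ (-p) * (x + 1) ^ (-q) ≤ x ^ (-(p + q)) := by
  rw [neg_add, Real.rpow_add hx]
  gcongr _ * ?_
  exact Real.rpow_le_rpow_of_nonpos hx (by linarith) (neg_nonpos.2 hq)

theorem norm_mul_legendreTriple_le (hm : CoeffDecay R A (γ + 2) m)
    (hu : CoeffDecay R B (γ + 4) u) (hβ0 : 0 ≤ β) (hβ : β ≤ 1 / 2) (hγ : -(9 / 2) ≤ γ)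
    (hF : 1 ≤ F) (hρ : ρ ∈ Set.Icc 0 R) {s l : ℕ} (hs : F ≤ s) (hl : 1 ≤ l) :
    ‖u s ρ * m l ρ * (legendreTriple l s n : ℂ)‖
      ≤ 2 * A * B * (F : ℝ) ^ (-(γ + 4.5)) * ((n : ℝ) + 1) ^ (-(1 / 2 - β))
        * (l : ℝ) ^ (-(2 + (γ + β))) := by
  have hA : 0 ≤ A := hm.nonneg (hρ.1.trans hρ.2)
  have hB : 0 ≤ B := hu.nonneg (hρ.1.trans hρ.2)
  have hl0 : (0 : ℝ) < l := by exact_mod_cast hl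
  have hF0 : (0 : ℝ) < F := by exact_mod_cast hF
  have hFs : (F : ℝ) ≤ s := by exact_mod_cast hs
  have hspow : (s : ℝ) ^ (-(γ + 4)) * ((s : ℝ) + 1) ^ (-(1 / 2) : ℝ) ≤ (F : ℝ) ^ (-(γ + 4.5)) := by
    refine (rpow_mul_succ_rpow_le (hF0.trans_le hFs) (γ + 4) one_half_pos.le).trans ?_
    rw [show γ + 4 + 1 / 2 = γ + 4.5 by norm_num [add_assoc]]
    exact Real.rpow_le_rpow_of_nonpos hF0 hFs (by norm_num; linarith)
  have hlpow : (l : ℝ) ^ (-(γ + 2)) * ((l : ℝ) + 1) ^ (-β) ≤ (l : ℝ) ^ (-(2 + (γ + β))) := by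
    rw [← add_assoc, add_comm 2 γ]
    exact rpow_mul_succ_rpow_le hl0 (γ + 2) hβ0
  rw [norm_mul, norm_mul, Complex.norm_real, Real.norm_eq_abs]
  calc ‖u s ρ‖ * ‖m l ρ‖ * |legendreTriple l s n|
      ≤ (B * (s : ℝ) ^ (-(γ + 4))) * (A * (l : ℝ) ^ (-(γ + 2)))
        * (2 * (((s : ℝ) + 1) ^ (-(1 / 2) : ℝ)
          * (((l : ℝ) + 1) ^ (-β) * ((n : ℝ) + 1) ^ (-(1 / 2 - β))))) := by
        gcongr
        · exact hu s (hF.trans hs) ρ hρ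
        · exact hm l hl ρ hρ
        · exact abs_legendreTriple_le_rpow l s n hβ0 hβ
    _ = 2 * A * B * ((s : ℝ) ^ (-(γ + 4)) * ((s : ℝ) + 1) ^ (-(1 / 2) : ℝ))
        * ((n : ℝ) + 1) ^ (-(1 / 2 - β)) * ((l : ℝ) ^ (-(γ + 2)) * ((l : ℝ) + 1) ^ (-β)) := by
        ring
    _ ≤ _ := by gcongr

theorem norm_angularIntegral_le (hβ0 : 0 ≤ β) (hβ : β ≤ 1 / 2) (hγβ : 0 < γ + β)
    (hm : CoeffDecay R A (γ + 2) m) (hu : CoeffDecay R B (γ + 4) u) (hρ : ρ ∈ Set.Icc 0 R)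
    (hF : 1 ≤ F) {r : ℕ} (hnr : n + r = F) :
    ‖angularIntegral (legendreSeries m) (legendreTail u F) n ρ‖
      ≤ (1 + 1 / (1 + (γ + β))) * (1 + 1 / (γ + β)) * (2 * A * B * (F : ℝ) ^ (-(γ + 4.5))
          * ((n : ℝ) + 1) ^ (-(1 / 2 - β))) * ((r : ℝ) + 1) ^ (-(γ + β)) := by
  have hA : 0 ≤ A := hm.nonneg (hρ.1.trans hρ.2)
  have hB : 0 ≤ B := hu.nonneg (hρ.1.trans hρ.2)
  have hsum := hasSum_angularIntegral (hm.summable_norm (by linarith) hρ)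
    (hu.summable_norm_add (by linarith) hρ F) n
  rw [← hsum.tsum_eq]
  refine (norm_tsum_le_tsum_norm hsum.summable.norm).trans ?_
  rw [← Nat.cast_add_one r]
  refine tsum_prod_le_of_eq_zero_of_le_rpow hγβ (by positivity) (Nat.le_add_left 1 r)
    hsum.summable.norm (fun i l hl => ?_) fun i l hl => ?_
  · rw [legendreTriple_eq_zero (by omega), Complex.ofReal_zero, mul_zero, norm_zero]
  · exact norm_mul_legendreTriple_le hm hu hβ0 hβ (by linarith) hF hρ (by omega) (by omega)

theorem exists_norm_truncatedOperator_le {κ : ℝ} (hκ : 0 < κ) (hR : 0 < R) (hβ0 : 0 ≤ β)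
    (hβ : β ≤ 1 / 2) (hγβ : 0 < γ + β) :
    ∃ C : ℝ, 0 < C ∧ ∀ (m u : ℕ → ℝ → ℂ) (A B : ℝ), CoeffDecay R A (γ + 2) m →
      CoeffDecay R B (γ + 4) u → ∀ F : ℕ, 1 ≤ F → ∀ a : ℝ, 0 ≤ a → ∀ θ : ℝ,
        ‖truncatedOperator κ R (legendreSeries m) F (legendreTail u F) a θ‖
          ≤ C * A * B * ((F : ℝ) ^ (-(γ + 4.5)) * powerConvolution (3 / 2 - β) (γ + β) F) := by
  refine ⟨8 * κ ^ 2 * R ^ 2 * Real.exp (κ * R + (κ * R) ^ 2)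
    * ((1 + 1 / (1 + (γ + β))) * (1 + 1 / (γ + β))), by positivity,
    fun m u A B hm hu F hF a ha θ => ?_⟩
  rw [truncatedOperator, powerConvolution, Finset.Nat.sum_antidiagonal_eq_sum_range_succ_mk,
    Finset.mul_sum, Finset.mul_sum]
  refine norm_sum_le_of_le _ fun n hn => (norm_mul_legendreP_cos_le _ _ _).trans ?_
  have hnF : n + (F - n) = F := Nat.add_sub_of_le (Finset.mem_range_succ_iff.1 hn)
  have hn : ((n : ℝ) + 1) ^ (-(3 / 2 - β)) = ((n : ℝ) + 1) ^ (-(1 / 2 - β)) / (n + 1) := by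
    rw [← Real.rpow_sub_one (by positivity)]
    ring_nf
  refine (norm_radialOperator_le hκ hR _ _ n ha fun ρ hρ =>
    norm_angularIntegral_le hβ0 hβ hγβ hm hu (Set.Ioc_subset_Icc_self hρ) hF hnF).trans_eq ?_
  rw [hn]
  ring

theorem exists_norm_truncatedOperator_le_rpow {κ : ℝ} (hκ : 0 < κ) (hR : 0 < R) (hγ : 1 < γ) :
    ∃ C : ℝ, 0 < C ∧ ∀ (m u : ℕ → ℝ → ℂ) (A B : ℝ), CoeffDecay R A (γ + 2) m →
      CoeffDecay R B (γ + 4) u → ∀ F : ℕ, 1 ≤ F → ∀ a : ℝ, 0 ≤ a → ∀ θ : ℝ,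
        ‖truncatedOperator κ R (legendreSeries m) F (legendreTail u F) a θ‖
          ≤ C * A * B * (F : ℝ) ^ (-(γ + 4.5 + min 1.5 γ)) := by
  obtain ⟨C₁, hC₁, hoperator⟩ := exists_norm_truncatedOperator_le (γ := γ) hκ hR le_rfl
    one_half_pos.le (by linarith)
  obtain ⟨C₂, hC₂, hconvolution⟩ := exists_powerConvolution_le_rpow (p := 1.5) (by norm_num) hγ
  refine ⟨C₁ * C₂, mul_pos hC₁ hC₂, fun m u A B hm hu F hF a ha θ => ?_⟩
  have hA : 0 ≤ A := hm.nonneg hR.le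
  have hB : 0 ≤ B := hu.nonneg hR.le
  have hF0 : (0 : ℝ) < F := by exact_mod_cast hF
  have hexponent : powerConvolution (3 / 2 - 0) (γ + 0) F = powerConvolution 1.5 γ F := by
    norm_num
  calc _ ≤ C₁ * A * B * ((F : ℝ) ^ (-(γ + 4.5)) * powerConvolution (3 / 2 - 0) (γ + 0) F) :=
        hoperator m u A B hm hu F hF a ha θ
    _ ≤ C₁ * A * B * ((F : ℝ) ^ (-(γ + 4.5)) * (C₂ * (F : ℝ) ^ (-min 1.5 γ))) := by
        rw [hexponent]
        gcongr
        exact hconvolution F hF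
    _ = _ := by
        rw [neg_add (γ + 4.5), Real.rpow_add hF0]
        ring

theorem exists_norm_truncatedOperator_le_log {κ : ℝ} (hκ : 0 < κ) (hR : 0 < R)
    (hγ : -(1 / 2) < γ) :
    ∃ C : ℝ, 0 < C ∧ ∀ (m u : ℕ → ℝ → ℂ) (A B : ℝ), CoeffDecay R A (γ + 2) m →
      CoeffDecay R B (γ + 4) u → ∀ F : ℕ, 2 ≤ F → ∀ a : ℝ, 0 ≤ a → ∀ θ : ℝ,
        ‖truncatedOperator κ R (legendreSeries m) F (legendreTail u F) a θ‖
          ≤ C * A * B * (Real.log F * (F : ℝ) ^ (-(γ + 4.5 + min 1 (0.5 + γ)))) := by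
  obtain ⟨C₁, hC₁, hoperator⟩ := exists_norm_truncatedOperator_le (γ := γ) hκ hR one_half_pos.le
    le_rfl (by linarith)
  obtain ⟨C₂, hC₂, hconvolution⟩ := exists_powerConvolution_one_le_log (q := 0.5 + γ)
    (by norm_num; linarith)
  refine ⟨C₁ * C₂, mul_pos hC₁ hC₂, fun m u A B hm hu F hF a ha θ => ?_⟩
  have hA : 0 ≤ A := hm.nonneg hR.le
  have hB : 0 ≤ B := hu.nonneg hR.le
  have hF0 : (0 : ℝ) < F := by exact_mod_cast two_pos.trans_le hF
  have hexponent : powerConvolution (3 / 2 - 1 / 2) (γ + 1 / 2) F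
      = powerConvolution 1 (0.5 + γ) F := by
    norm_num [add_comm]
  calc _ ≤ C₁ * A * B
        * ((F : ℝ) ^ (-(γ + 4.5)) * powerConvolution (3 / 2 - 1 / 2) (γ + 1 / 2) F) :=
        hoperator m u A B hm hu F (one_le_two.trans hF) a ha θ
    _ ≤ C₁ * A * B * ((F : ℝ) ^ (-(γ + 4.5))
        * (C₂ * (Real.log F * (F : ℝ) ^ (-min 1 (0.5 + γ))))) := by
        rw [hexponent]
        gcongr
        exact hconvolution F hF
    _ = _ := by
        rw [neg_add (γ + 4.5), Real.rpow_add hF0]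
        ring

end Operator

end

end HelmholtzScattering

open HelmholtzScattering in
theorem mainTheorem2_general (κ R : ℝ) (hκ : 0 < κ) (hR : 0 < R) (γ : ℝ) (hγ : -(1 / 2) < γ) :
    ∃ C : ℝ, 0 < C ∧
      ∀ (m u : ℕ → ℝ → ℂ) (A B : ℝ),
        (∀ l, MeasureTheory.AEStronglyMeasurable (m l)
          (MeasureTheory.volume.restrict (Set.Icc 0 R))) →
        (∀ s, MeasureTheory.AEStronglyMeasurable (u s)
          (MeasureTheory.volume.restrict (Set.Icc 0 R))) →
        CoeffDecay R A (γ + 2) m → CoeffDecay R B (γ + 4) u →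
        (1 < γ → ∀ F : ℕ, 1 ≤ F → ∀ a : ℝ, 0 ≤ a → ∀ θ : ℝ,
          ‖truncatedOperator κ R (legendreSeries m) F (legendreTail u F) a θ‖
            ≤ C * A * B * (F : ℝ) ^ (-(γ + 4.5 + min 1.5 γ))) ∧
        (∀ F : ℕ, 2 ≤ F → ∀ a : ℝ, 0 ≤ a → ∀ θ : ℝ,
          ‖truncatedOperator κ R (legendreSeries m) F (legendreTail u F) a θ‖
            ≤ C * A * B * (Real.log F * (F : ℝ) ^ (-(γ + 4.5 + min 1 (0.5 + γ))))) := by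
  obtain ⟨C₁, hC₁, hlog⟩ := exists_norm_truncatedOperator_le_log hκ hR hγ
  by_cases hγ1 : 1 < γ
  · obtain ⟨C₂, _, hrpow⟩ := exists_norm_truncatedOperator_le_rpow hκ hR hγ1
    refine ⟨max C₁ C₂, lt_max_of_lt_left hC₁, fun m u A B _ _ hm hu => ?_⟩
    have hA : 0 ≤ A := hm.nonneg hR.le
    have hB : 0 ≤ B := hu.nonneg hR.le
    refine ⟨fun _ F hF a ha θ => (hrpow m u A B hm hu F hF a ha θ).trans ?_,
      fun F hF a ha θ => (hlog m u A B hm hu F hF a ha θ).trans ?_⟩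
    · gcongr
      exact le_max_right _ _
    · gcongr
      exact le_max_left _ _
  · exact ⟨C₁, hC₁, fun m u A B _ _ hm hu => ⟨fun h => absurd h hγ1, hlog m u A B hm hu⟩⟩

theorem mainTheorem2 (κ R : ℝ) (hκ : 0 < κ) (hR : 0 < R) (k : ℕ) (α : ℝ) (hα : 0 < α) :
    ∃ C : ℝ, 0 < C ∧
      ∀ (m u : ℕ → ℝ → ℂ) (A B : ℝ),
        (∀ l, MeasureTheory.AEStronglyMeasurable (m l)
          (MeasureTheory.volume.restrict (Set.Icc 0 R))) →
        (∀ s, MeasureTheory.AEStronglyMeasurable (u s)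
          (MeasureTheory.volume.restrict (Set.Icc 0 R))) →
        (∀ l : ℕ, 1 ≤ l → ∀ ρ ∈ Set.Icc 0 R,
          ‖m l ρ‖ ≤ A * (l : ℝ) ^ (-((k : ℝ) + 2 + α))) →
        (∀ s : ℕ, 1 ≤ s → ∀ ρ ∈ Set.Icc 0 R,
          ‖u s ρ‖ ≤ B * (s : ℝ) ^ (-((k : ℝ) + 4 + α))) →
        (1 ≤ k → ∀ F : ℕ, 1 ≤ F → ∀ a : ℝ, 0 ≤ a → ∀ θ : ℝ,
          ‖HelmholtzScattering.truncatedOperator κ R (HelmholtzScattering.legendreSeries m) F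
              (HelmholtzScattering.legendreTail u F) a θ‖
            ≤ C * A * B * (F : ℝ) ^ (-((k : ℝ) + 4.5 + α + min 1.5 ((k : ℝ) + α)))) ∧
        (k = 0 → ∀ F : ℕ, 2 ≤ F → ∀ a : ℝ, 0 ≤ a → ∀ θ : ℝ,
          ‖HelmholtzScattering.truncatedOperator κ R (HelmholtzScattering.legendreSeries m) F
              (HelmholtzScattering.legendreTail u F) a θ‖
            ≤ C * A * B * (Real.log F * (F : ℝ) ^ (-(4.5 + α + min 1 (0.5 + α))))) := by
  obtain ⟨C, hC, h⟩ := mainTheorem2_general κ R hκ hR (k + α)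
    ((neg_lt_zero.2 one_half_pos).trans (by positivity))
  simp only [HelmholtzScattering.CoeffDecay, add_right_comm (k : ℝ) α] at h
  refine ⟨C, hC, fun m u A B hm_meas hu_meas hm hu => ?_⟩
  obtain ⟨hpow, hlog⟩ := h m u A B hm_meas hu_meas hm hu
  refine ⟨fun hk => hpow (lt_add_of_le_of_pos (by exact_mod_cast hk) hα), ?_⟩
  rintro rfl
  simpa only [Nat.cast_zero, zero_add] using hlog
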